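/- Let $\Delta, M>0$ and let $f$ be a probability density on $\mathbb{R}$ with $f(-x)=f(x)$ for all $x$, with no mass outside $[-\Delta,\Delta]$, and whose cumulative distribution function is strictly increasing on $[-\Delta,\Delta]$. Let $\eta\ge 2$, let $N\ge 2$ be an integer and let $0<\alpha\le 1$. There are $N$ nodes; a uniformly random set $\mathcal{T}$ of $N-1$ of them is adversarial and the remaining node $h$ is honest. Node $i$ reports $\mathbf{y}_i=\mathbf{u}+\mathbf{n}_i$, where $\mathbf{u}\sim\mathrm{Unif}[-M,M]$, the honest noise $\mathbf{n}_h$ has density $f$, the adversarial noise vector $(\mathbf{n}_a)_{a\in\mathcal{T}}$ has an arbitrary joint probability distribution $g$ on $\mathbb{R}^{N-1}$, and $\mathcal{T}$, $\mathbf{u}$, $\mathbf{n}_h$ and $(\mathbf{n}_a)_{a\in\mathcal{T}}$ are independent. The reports are accepted if $\max_i \mathbf{y}_i-\min_i \mathbf{y}_i\le\eta\Delta$. Let $\mathsf{PA}(g,\eta)$ be the probability of acceptance and let $$\mathsf{MSE}(g,\eta)=\mathbb{E}\left[\left(\mathbf{u}-\tfrac12\left(\max_i\mathbf{y}_i+\min_i\mathbf{y}_i\right)\right)^2\,\Big|\,\text{accepted}\right].$$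 For $(\eta-1)\Delta\le z\le(\eta+1)\Delta$ put $$k_\eta(z)=\int_{z-\eta\Delta}^{\Delta}f(x)\,dx,\qquad \nu_\eta(z)=\int_{z-\eta\Delta}^{\Delta}(x+z)^2f(x)\,dx .$$ Then $k_\eta$ is a bijection from $[(\eta-1)\Delta,(\eta+1)\Delta]$ onto $[0,1]$. Let $h_\eta=\nu_\eta\circ k_\eta^{-1}$ on $[0,1]$ and let $h_\eta^*$ be its concave envelope, i.e. the least concave function on $[0,1]$ that is $\ge h_\eta$. The maximum $$c_\eta^N(\alpha)=\max\left\{\mathsf{MSE}(g,\eta) : g \text{ a probability distribution on } \mathbb{R}^{N-1},\ \mathsf{PA}(g,\eta)\ge\alpha\right\}$$ is attained, and $$c_\eta^N(\alpha)=\frac{h_\eta^*(\alpha)}{4\alpha}.$$ -/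

import Mathlib

open MeasureTheory ProbabilityTheory Set

noncomputable section

namespace CodingGame

/-- The law of the honest noise: the measure on `ℝ` with Lebesgue density `f`. -/
def noiseLaw (f : ℝ → ℝ) : Measure ℝ :=
  volume.withDensity fun x => ENNReal.ofReal (f x)

/-- `f` is a symmetric probability density which puts no mass outside `[-Δ, Δ]` and whose
cumulative distribution function is strictly increasing on `[-Δ, Δ]`. -/
structure IsHonestDensity (f : ℝ → ℝ) (Δ : ℝ) : Prop where
  measurable : Measurable f
  nonneg : ∀ x, 0 ≤ f x
  lintegral_eq_one : ∫⁻ x, ENNReal.ofReal (f x) = 1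
  symmetric : ∀ x, f (-x) = f x
  bounded_range : noiseLaw f {x | Δ < |x|} = 0
  cdf_strictMono : StrictMonoOn (cdf (noiseLaw f)) (Icc (-Δ) Δ)

/-- Outcomes of the experiment with `m` adversarial nodes and one honest node:
the position of the honest node among the `m + 1` nodes, the value `u`, the honest noise, and the
vector of the adversarial noises. -/
abbrev Outcome (m : ℕ) : Type := Fin (m + 1) × ℝ × ℝ × (Fin m → ℝ)

/-- The law of the experiment. The honest position (equivalently the set of the `m` adversarial
positions) is uniform, `u` is uniform on `[-M, M]`, the honest noise has density `f`, the
adversarial noises have the joint law `g`, and these four are independent. -/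
def gameLaw (m : ℕ) (M : ℝ) (f : ℝ → ℝ) (g : Measure (Fin m → ℝ)) : Measure (Outcome m) :=
  (uniformOn (univ : Set (Fin (m + 1)))).prod
    ((ProbabilityTheory.cond volume (Icc (-M) M)).prod ((noiseLaw f).prod g))

/-- The report of node `i`: `u` plus its noise. The honest node carries the honest noise, the
other nodes carry the adversarial noises in increasing order of position. -/
def report {m : ℕ} (ω : Outcome m) (i : Fin (m + 1)) : ℝ :=
  ω.2.1 + Fin.insertNth (α := fun _ => ℝ) ω.1 ω.2.2.1 ω.2.2.2 i

/-- The largest report. -/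
def maxReport {m : ℕ} (ω : Outcome m) : ℝ := ⨆ i, report ω i

/-- The smallest report. -/
def minReport {m : ℕ} (ω : Outcome m) : ℝ := ⨅ i, report ω i

/-- The event that the reports are accepted. -/
def accepted (m : ℕ) (Δ η : ℝ) : Set (Outcome m) :=
  {ω | maxReport ω - minReport ω ≤ η * Δ}

/-- The probability of acceptance. -/
def PA (m : ℕ) (M Δ : ℝ) (f : ℝ → ℝ) (g : Measure (Fin m → ℝ)) (η : ℝ) : ℝ :=
  (gameLaw m M f g).real (accepted m Δ η)

/-- The mean squared error of the midrange estimate of `u`, conditionally on acceptance. -/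
def MSE (m : ℕ) (M Δ : ℝ) (f : ℝ → ℝ) (g : Measure (Fin m → ℝ)) (η : ℝ) : ℝ :=
  ∫ ω, (ω.2.1 - (maxReport ω + minReport ω) / 2) ^ 2
    ∂(ProbabilityTheory.cond (gameLaw m M f g) (accepted m Δ η))

/-- The values of the conditional MSE over all joint laws of the adversarial noises for which the
acceptance probability is at least `α`. -/
def feasibleMSE (m : ℕ) (M Δ : ℝ) (f : ℝ → ℝ) (η α : ℝ) : Set ℝ :=
  {e | ∃ g : Measure (Fin m → ℝ), IsProbabilityMeasure g ∧
    α ≤ PA m M Δ f g η ∧ e = MSE m M Δ f g η}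

/-- The optimal value `c_η^N(α)` of the adversary's problem with `N` nodes, `N - 1` of them
adversarial. -/
def optMSE (N : ℕ) (M Δ : ℝ) (f : ℝ → ℝ) (η α : ℝ) : ℝ :=
  sSup (feasibleMSE (N - 1) M Δ f η α)

/-- `k_η(z) = ∫_{z - ηΔ}^{Δ} f(x) dx`. -/
def kFun (Δ : ℝ) (f : ℝ → ℝ) (η z : ℝ) : ℝ := ∫ x in (z - η * Δ)..Δ, f x

/-- `ν_η(z) = ∫_{z - ηΔ}^{Δ} (x + z)² f(x) dx`. -/
def nuFun (Δ : ℝ) (f : ℝ → ℝ) (η z : ℝ) : ℝ := ∫ x in (z - η * Δ)..Δ, (x + z) ^ 2 * f x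

/-- The interval `[(η - 1)Δ, (η + 1)Δ]` on which `k_η` and `ν_η` are considered. -/
def zRange (Δ η : ℝ) : Set ℝ := Icc ((η - 1) * Δ) ((η + 1) * Δ)

/-- `h_η = ν_η ∘ k_η⁻¹`, with `k_η⁻¹` the inverse of `k_η` on `[(η - 1)Δ, (η + 1)Δ]`. -/
def hFun (Δ : ℝ) (f : ℝ → ℝ) (η q : ℝ) : ℝ :=
  nuFun Δ f η (Function.invFunOn (kFun Δ f η) (zRange Δ η) q)

/-- The concave envelope of `h` on `s`: the pointwise infimum of its concave majorants on `s`. -/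
def concaveEnvelope (s : Set ℝ) (h : ℝ → ℝ) (q : ℝ) : ℝ :=
  sInf {y | ∃ φ : ℝ → ℝ, ConcaveOn ℝ s φ ∧ (∀ p ∈ s, h p ≤ φ p) ∧ y = φ q}

end CodingGame

end

/-! A report is `u` plus a noise, so `u` and the position of the honest node drop out: acceptance
and the error depend only on the honest noise `x` and on the largest and smallest adversarial noises
`A` and `B`. A law `g` thus enters only through two averages, the acceptance probability and the
unnormalized squared error, and the MSE is a quarter of their ratio.

For fixed `A` and `B`, `exists_nuFun_ge` finds a point of the curve `(k_η(z), ν_η(z))` with the same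
probability and at least the same error. By reflection `|B| ≤ A` may be assumed; then replacing `B`
by `A` does not lower the error, and among events of given probability an upper half-line is worst.
Averaging over `g` gives a point on or below the convex hull of the curve
(`exists_mem_curveHull_ge`). Conversely, mixtures of laws in which all adversaries share one noise
`z` realize the whole hull (`exists_law_of_mem_curveHull`).

The upper boundary of this compact hull is the concave envelope of `h_η`. The hull contains the
origin, so a point with probability above `α` can be scaled down to `α` with its ratio unchanged. -/

noncomputable section

namespace CodingGame

/-! ### Convex hulls and concave envelopes -/

/-- In a finite dimensional space the convex hull of a compact set is compact. -/
theorem isCompact_convexHull_of_finiteDimensional {E : Type*} [NormedAddCommGroup E]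
    [NormedSpace ℝ E] [FiniteDimensional ℝ E] {s : Set E} (hs : IsCompact s) :
    IsCompact (convexHull ℝ s) := by
  rcases s.eq_empty_or_nonempty with rfl | ⟨x₀, hx₀⟩
  · simp
  set n := Module.finrank ℝ E + 1 with hn
  have hcomp : IsCompact ((stdSimplex ℝ (Fin n)) ×ˢ (univ.pi fun _ : Fin n => s)) :=
    (isCompact_stdSimplex ℝ (Fin n)).prod (isCompact_univ_pi fun _ => hs)
  have hcont : Continuous fun p : (Fin n → ℝ) × (Fin n → E) => ∑ i, p.1 i • p.2 i := by
    fun_prop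
  convert hcomp.image hcont using 1
  apply Subset.antisymm
  · intro x hx
    -- Carathéodory: affine independence bounds the number of points by the dimension plus one.
    obtain ⟨ι, _, z, w, hz, hind, hw, hw1, hx⟩ := eq_pos_convex_span_of_mem_convexHull hx
    have hcard : Fintype.card ι ≤ Fintype.card (Fin n) := by
      simpa [hn] using hind.card_le_finrank_succ.trans
        (Nat.succ_le_succ (Submodule.finrank_le _))
    obtain ⟨e⟩ := Function.Embedding.nonempty_of_card_le hcard
    -- Unused indices get weight 0 and the dummy point `x₀` of `s`.
    refine ⟨(Function.extend e w 0, Function.extend e z fun _ => x₀), ⟨⟨?_, ?_⟩, ?_⟩, ?_⟩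
    · intro j
      by_cases hj : ∃ i, e i = j
      · obtain ⟨i, rfl⟩ := hj
        simpa [e.injective.extend_apply] using (hw i).le
      · simp [Function.extend_apply' _ _ _ hj]
    · have h := Fintype.sum_of_injective e e.injective w (Function.extend e w 0)
        (fun j hj => Function.extend_apply' _ _ _ hj)
        (fun i => (e.injective.extend_apply _ _ _).symm)
      exact h.symm.trans hw1
    · intro j _
      by_cases hj : ∃ i, e i = j
      · obtain ⟨i, rfl⟩ := hj
        simpa [e.injective.extend_apply] using hz ⟨i, rfl⟩
      · simpa [Function.extend_apply' _ _ _ hj] using hx₀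
    · have h := Fintype.sum_of_injective e e.injective (fun i => w i • z i)
        (fun j => Function.extend e w 0 j • Function.extend e z (fun _ => x₀) j)
        (fun j hj => by rw [Function.extend_apply' w _ _ hj]; simp)
        (fun i => by simp [e.injective.extend_apply])
      exact h.symm.trans hx
  · rintro _ ⟨⟨w, z⟩, ⟨hw, hz⟩, rfl⟩
    exact (convex_convexHull ℝ s).sum_mem (fun i _ => hw.1 i) hw.2
      fun i _ => subset_convexHull ℝ s (hz i (mem_univ i))

/-- If the graph of `h` on `s` has compact convex hull, the concave envelope is the largest
ordinate of that hull. -/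
theorem isGreatest_concaveEnvelope {s : Set ℝ} (hs : Convex ℝ s) {h : ℝ → ℝ} {C : Set (ℝ × ℝ)}
    (hC : IsCompact C) (hCh : C = convexHull ℝ ((fun q => (q, h q)) '' s)) {q : ℝ} (hq : q ∈ s) :
    IsGreatest {y | (q, y) ∈ C} (concaveEnvelope s h q) := by
  have hconv : Convex ℝ C := hCh ▸ convex_convexHull ℝ _
  have hgraph : ∀ p ∈ s, (p, h p) ∈ C := fun p hp =>
    hCh ▸ subset_convexHull ℝ _ ⟨p, hp, rfl⟩
  have hfib : ∀ p, IsCompact {y | (p, y) ∈ C} := fun p => by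
    have : {y | (p, y) ∈ C} = Prod.snd '' (C ∩ Prod.fst ⁻¹' {p}) := by
      ext y
      constructor
      · intro hy
        exact ⟨(p, y), ⟨hy, rfl⟩, rfl⟩
      · rintro ⟨⟨a, b⟩, ⟨hab, rfl⟩, rfl⟩
        exact hab
    rw [this]
    exact (hC.inter_right (isClosed_singleton.preimage continuous_fst)).image continuous_snd
  -- The upper boundary of `C`, attained because the fibres are compact, is itself a concave
  -- majorant of `h`.
  set ψ : ℝ → ℝ := fun p => sSup {y | (p, y) ∈ C} with hψ
  have hψg : ∀ p ∈ s, IsGreatest {y | (p, y) ∈ C} (ψ p) := fun p hp =>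
    (hfib p).isGreatest_sSup ⟨_, hgraph p hp⟩
  have hψc : ConcaveOn ℝ s ψ := by
    refine ⟨hs, fun x hx y hy a b ha hb hab => ?_⟩
    refine (hψg _ (hs hx hy ha hb hab)).2 ?_
    have := hconv (hψg x hx).1 (hψg y hy).1 ha hb hab
    simpa using this
  have hle : ∀ φ : ℝ → ℝ, ConcaveOn ℝ s φ → (∀ p ∈ s, h p ≤ φ p) → ψ q ≤ φ q := by
    intro φ hφ hhφ
    -- The hypograph of a concave majorant is convex and contains the graph, hence contains `C`.
    have hsub : C ⊆ {p : ℝ × ℝ | p.1 ∈ s ∧ p.2 ≤ φ p.1} := by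
      rw [hCh]
      refine convexHull_min ?_ hφ.convex_hypograph
      rintro _ ⟨p, hp, rfl⟩
      exact ⟨hp, hhφ p hp⟩
    exact (hsub (hψg q hq).1).2
  have heq : concaveEnvelope s h q = ψ q := by
    refine IsLeast.csInf_eq ⟨⟨ψ, hψc, fun p hp => (hψg p hp).2 (hgraph p hp), rfl⟩, ?_⟩
    rintro _ ⟨φ, hφ, hhφ, rfl⟩
    exact hle φ hφ hhφ
  rw [heq]
  exact hψg q hq

/-! ### The honest noise -/

namespace IsHonestDensity

variable {f : ℝ → ℝ} {Δ : ℝ}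

theorem isProbabilityMeasure (hf : IsHonestDensity f Δ) : IsProbabilityMeasure (noiseLaw f) :=
  ⟨by simpa [noiseLaw] using hf.lintegral_eq_one⟩

theorem noAtoms : NullSingletonClass (noiseLaw f) := by
  unfold noiseLaw; infer_instance

theorem ae_abs_le (hf : IsHonestDensity f Δ) : ∀ᵐ x ∂noiseLaw f, |x| ≤ Δ := by
  rw [ae_iff]
  simpa using hf.bounded_range

theorem integrable (hf : IsHonestDensity f Δ) : Integrable f := by
  refine ⟨hf.measurable.aestronglyMeasurable, ?_⟩
  rw [hasFiniteIntegral_iff_ofReal (Filter.Eventually.of_forall hf.nonneg), hf.lintegral_eq_one]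
  exact ENNReal.one_lt_top

theorem measurePreserving_neg (hf : IsHonestDensity f Δ) :
    MeasurePreserving Neg.neg (noiseLaw f) (noiseLaw f) := by
  refine ⟨measurable_neg, ?_⟩
  ext s hs
  rw [Measure.map_apply measurable_neg hs, noiseLaw, withDensity_apply _ hs,
    withDensity_apply _ (measurable_neg hs)]
  rw [← (Measure.measurePreserving_neg (volume : Measure ℝ)).setLIntegral_comp_preimage hs
    hf.measurable.ennreal_ofReal]
  simp only [hf.symmetric]

theorem integral_comp_neg (hf : IsHonestDensity f Δ) (φ : ℝ → ℝ) :
    ∫ x, φ (-x) ∂noiseLaw f = ∫ x, φ x ∂noiseLaw f :=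
  hf.measurePreserving_neg.integral_comp (MeasurableEquiv.neg ℝ).measurableEmbedding φ

theorem setIntegral_eq (hf : IsHonestDensity f Δ) {s : Set ℝ} (hs : MeasurableSet s)
    (φ : ℝ → ℝ) : ∫ x in s, φ x ∂noiseLaw f = ∫ x in s, φ x * f x := by
  rw [noiseLaw, setIntegral_withDensity_eq_setIntegral_toReal_smul
    hf.measurable.ennreal_ofReal (by simp) _ hs]
  refine setIntegral_congr_fun hs fun x _ => ?_
  simp [ENNReal.toReal_ofReal (hf.nonneg x), mul_comm]

/-- A measurable function which is bounded on `[-Δ, Δ]` is integrable for the noise. -/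
theorem integrable_of_bound (hf : IsHonestDensity f Δ) {φ : ℝ → ℝ} (hφ : Measurable φ) (C : ℝ)
    (h : ∀ x, |x| ≤ Δ → |φ x| ≤ C) : Integrable φ (noiseLaw f) := by
  have := hf.isProbabilityMeasure
  exact Integrable.of_bound hφ.aestronglyMeasurable C (hf.ae_abs_le.mono fun x hx => h x hx)

theorem integrable_sq (hf : IsHonestDensity f Δ) (z : ℝ) :
    Integrable (fun x => (x + z) ^ 2) (noiseLaw f) := by
  refine hf.integrable_of_bound (by fun_prop) ((Δ + |z|) ^ 2) fun x hx => ?_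
  rw [abs_pow]
  gcongr
  exact (abs_add_le x z).trans (by gcongr)

theorem setIntegral_Ioc_eq_Ici (hf : IsHonestDensity f Δ) (t : ℝ) (φ : ℝ → ℝ) :
    ∫ x in Ioc t Δ, φ x ∂noiseLaw f = ∫ x in Ici t, φ x ∂noiseLaw f := by
  have := noAtoms (f := f)
  rw [integral_Ici_eq_integral_Ioi]
  refine setIntegral_congr_set ?_
  filter_upwards [hf.ae_abs_le] with x hx
  refine propext ⟨fun h => h.1, fun h => ⟨h, (le_abs_self x).trans hx⟩⟩

end IsHonestDensity

/-! ### The curve of `k_η` and `ν_η` -/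

variable {f : ℝ → ℝ} {Δ η : ℝ}

theorem kFun_eq_real (hf : IsHonestDensity f Δ) {z : ℝ} (hz : z ≤ (η + 1) * Δ) :
    kFun Δ f η z = (noiseLaw f).real (Ici (z - η * Δ)) := by
  have h := hf.setIntegral_Ioc_eq_Ici (z - η * Δ) fun _ => 1
  rw [hf.setIntegral_eq measurableSet_Ioc] at h
  rw [kFun, intervalIntegral.integral_of_le (by linarith)]
  simpa using h

theorem nuFun_eq_setIntegral (hf : IsHonestDensity f Δ) {z : ℝ} (hz : z ≤ (η + 1) * Δ) :
    nuFun Δ f η z = ∫ x in Ici (z - η * Δ), (x + z) ^ 2 ∂noiseLaw f := by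
  rw [← hf.setIntegral_Ioc_eq_Ici, hf.setIntegral_eq measurableSet_Ioc, nuFun,
    intervalIntegral.integral_of_le (by linarith)]

theorem continuous_intervalIntegral_sub_mul (hf : IsHonestDensity f Δ) (c : ℝ) {φ : ℝ → ℝ}
    (hφ : Continuous φ) : Continuous fun z => ∫ x in (z - c)..Δ, φ x * f x := by
  have hi : ∀ a b, IntervalIntegrable (fun x => φ x * f x) volume a b := fun a b =>
    hf.integrable.intervalIntegrable.continuousOn_mul hφ.continuousOn
  have h := (intervalIntegral.continuous_primitive hi Δ).neg.comp
    (continuous_id.sub (continuous_const (y := c)))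
  refine h.congr fun z => ?_
  simp [intervalIntegral.integral_symm Δ]

theorem continuous_kFun (hf : IsHonestDensity f Δ) : Continuous (kFun Δ f η) := by
  refine (continuous_intervalIntegral_sub_mul hf (η * Δ) (continuous_const (y := 1))).congr
    fun z => ?_
  simp [kFun]

theorem continuous_nuFun (hf : IsHonestDensity f Δ) : Continuous (nuFun Δ f η) := by
  -- Expanding the square takes `z` out of the integrand and leaves primitives of integrable
  -- functions.
  have h : nuFun Δ f η = fun z => (∫ x in (z - η * Δ)..Δ, x ^ 2 * f x)
      + 2 * z * (∫ x in (z - η * Δ)..Δ, x * f x) + z ^ 2 * (∫ x in (z - η * Δ)..Δ, 1 * f x) := by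
    funext z
    have hi : ∀ {φ : ℝ → ℝ}, Continuous φ →
        IntervalIntegrable (fun x => φ x * f x) volume (z - η * Δ) Δ := fun hφ =>
      hf.integrable.intervalIntegrable.continuousOn_mul hφ.continuousOn
    rw [← intervalIntegral.integral_const_mul, ← intervalIntegral.integral_const_mul,
      ← intervalIntegral.integral_add (hi (by fun_prop)) ((hi (by fun_prop)).const_mul _),
      ← intervalIntegral.integral_add ((hi (by fun_prop)).add ((hi (by fun_prop)).const_mul _))
        ((hi (by fun_prop)).const_mul _)]
    exact intervalIntegral.integral_congr fun x _ => by ring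
  rw [h]
  have h2 := continuous_intervalIntegral_sub_mul hf (η * Δ) (continuous_pow 2)
  have h1 := continuous_intervalIntegral_sub_mul hf (η * Δ) continuous_id
  have h0 := continuous_intervalIntegral_sub_mul hf (η * Δ) (continuous_const (y := 1))
  exact (h2.add ((continuous_const.mul continuous_id).mul h1)).add ((continuous_id.pow 2).mul h0)

theorem kFun_eq_one_sub_cdf (hf : IsHonestDensity f Δ) {z : ℝ} (hz : z ≤ (η + 1) * Δ) :
    kFun Δ f η z = 1 - cdf (noiseLaw f) (z - η * Δ) := by
  have := hf.isProbabilityMeasure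
  have := IsHonestDensity.noAtoms (f := f)
  rw [kFun_eq_real hf hz, cdf_eq_real, ← probReal_compl_eq_one_sub measurableSet_Iic, compl_Iic]
  exact measureReal_congr Ioi_ae_eq_Ici.symm

theorem strictAntiOn_kFun (hf : IsHonestDensity f Δ) :
    StrictAntiOn (kFun Δ f η) (zRange Δ η) := by
  intro x hx y hy hxy
  rw [kFun_eq_one_sub_cdf hf hx.2, kFun_eq_one_sub_cdf hf hy.2]
  have := hf.cdf_strictMono (a := x - η * Δ) (b := y - η * Δ)
    ⟨by linarith [hx.1], by linarith [hx.2]⟩ ⟨by linarith [hy.1], by linarith [hy.2]⟩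
    (by linarith)
  linarith

theorem kFun_right : kFun Δ f η ((η + 1) * Δ) = 0 := by
  have : (η + 1) * Δ - η * Δ = Δ := by ring
  simp [kFun, this]

theorem nuFun_right : nuFun Δ f η ((η + 1) * Δ) = 0 := by
  have : (η + 1) * Δ - η * Δ = Δ := by ring
  simp [nuFun, this]

theorem restrict_Ici_left (hf : IsHonestDensity f Δ) :
    (noiseLaw f).restrict (Ici ((η - 1) * Δ - η * Δ)) = noiseLaw f := by
  refine Measure.restrict_eq_self_of_ae_mem ?_
  filter_upwards [hf.ae_abs_le] with x hx
  have := neg_abs_le x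
  simp only [mem_Ici]
  linarith

theorem kFun_left (hΔ : 0 < Δ) (hf : IsHonestDensity f Δ) : kFun Δ f η ((η - 1) * Δ) = 1 := by
  have := hf.isProbabilityMeasure
  rw [kFun_eq_real hf (by linarith), measureReal_def, ← Measure.restrict_apply_univ,
    restrict_Ici_left hf]
  simp

theorem bijOn_kFun (hΔ : 0 < Δ) (hf : IsHonestDensity f Δ) :
    BijOn (kFun Δ f η) (zRange Δ η) (Icc 0 1) := by
  have hle : (η - 1) * Δ ≤ (η + 1) * Δ := by linarith
  have hl : (η - 1) * Δ ∈ zRange Δ η := ⟨le_rfl, hle⟩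
  have hr : (η + 1) * Δ ∈ zRange Δ η := ⟨hle, le_rfl⟩
  refine ⟨fun z hz => ?_, (strictAntiOn_kFun hf).injOn, ?_⟩
  · have h0 := (strictAntiOn_kFun hf).antitoneOn hz hr hz.2
    have h1 := (strictAntiOn_kFun hf).antitoneOn hl hz hz.1
    rw [kFun_right] at h0
    rw [kFun_left hΔ hf] at h1
    exact ⟨h0, h1⟩
  · have : (zRange Δ η).OrdConnected := ordConnected_Icc
    have h := (continuous_kFun (η := η) hf).continuousOn.surjOn_Icc hr hl
    rwa [kFun_right, kFun_left hΔ hf] at h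

theorem hFun_kFun (hΔ : 0 < Δ) (hf : IsHonestDensity f Δ) {z : ℝ} (hz : z ∈ zRange Δ η) :
    hFun Δ f η (kFun Δ f η z) = nuFun Δ f η z := by
  rw [hFun, (bijOn_kFun hΔ hf).injOn.leftInvOn_invFunOn hz]

/-- The convex hull of the curve `z ↦ (k_η(z), ν_η(z))`. -/
def curveHull (Δ : ℝ) (f : ℝ → ℝ) (η : ℝ) : Set (ℝ × ℝ) :=
  convexHull ℝ ((fun z => (kFun Δ f η z, nuFun Δ f η z)) '' zRange Δ η)

theorem mem_curveHull {z : ℝ} (hz : z ∈ zRange Δ η) :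
    (kFun Δ f η z, nuFun Δ f η z) ∈ curveHull Δ f η :=
  subset_convexHull ℝ _ ⟨z, hz, rfl⟩

theorem isCompact_curveHull (hf : IsHonestDensity f Δ) : IsCompact (curveHull Δ f η) :=
  isCompact_convexHull_of_finiteDimensional (isCompact_Icc.image
    ((continuous_kFun hf).prodMk (continuous_nuFun hf)))

theorem curveHull_eq_graph (hΔ : 0 < Δ) (hf : IsHonestDensity f Δ) :
    curveHull Δ f η = convexHull ℝ ((fun q => (q, hFun Δ f η q)) '' Icc 0 1) := by
  rw [curveHull, ← (bijOn_kFun (η := η) hΔ hf).image_eq, image_image]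
  congr 1
  exact image_congr fun z hz => by rw [hFun_kFun hΔ hf hz]

/-! ### Fixed extreme adversarial noises -/

/-- The honest noises that lead to acceptance at tolerance `c`, when the largest and the smallest
adversarial noises are `A` and `B`. -/
def acceptSet (c A B : ℝ) : Set ℝ := {x | max A x - min B x ≤ c}

/-- The acceptance probability given the extreme adversarial noises. -/
def acceptProb (f : ℝ → ℝ) (c A B : ℝ) : ℝ := (noiseLaw f).real (acceptSet c A B)

/-- The integral over the acceptance event of the squared sum of the extreme noises, given the
extreme adversarial noises. -/
def acceptError (f : ℝ → ℝ) (c A B : ℝ) : ℝ :=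
  ∫ x in acceptSet c A B, (max A x + min B x) ^ 2 ∂noiseLaw f

theorem measurableSet_acceptSet (c A B : ℝ) : MeasurableSet (acceptSet c A B) :=
  measurableSet_le (by fun_prop) measurable_const

theorem neg_mem_acceptSet {c A B x : ℝ} : -x ∈ acceptSet c (-B) (-A) ↔ x ∈ acceptSet c A B := by
  simp only [acceptSet, mem_ofPred_eq, max_neg_neg, min_neg_neg]
  rw [show -min B x - -max A x = max A x - min B x by ring]

/-- The noise is symmetric and negation exchanges maximum and minimum. With `acceptError_neg`, this
allows the assumption `|B| ≤ A`. -/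
theorem acceptProb_neg (hf : IsHonestDensity f Δ) (c A B : ℝ) :
    acceptProb f c (-B) (-A) = acceptProb f c A B := by
  rw [acceptProb, acceptProb, measureReal_def, measureReal_def,
    ← hf.measurePreserving_neg.measure_preimage (measurableSet_acceptSet _ _ _).nullMeasurableSet]
  congr 2
  ext x
  exact neg_mem_acceptSet

theorem acceptError_neg (hf : IsHonestDensity f Δ) (c A B : ℝ) :
    acceptError f c (-B) (-A) = acceptError f c A B := by
  rw [acceptError, acceptError, ← integral_indicator (measurableSet_acceptSet _ _ _),
    ← integral_indicator (measurableSet_acceptSet _ _ _), ← hf.integral_comp_neg]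
  congr 1
  ext x
  by_cases hx : x ∈ acceptSet c A B
  · rw [indicator_of_mem hx, indicator_of_mem (neg_mem_acceptSet.2 hx), max_neg_neg, min_neg_neg]
    ring
  · rw [indicator_of_notMem hx, indicator_of_notMem (fun h => hx (neg_mem_acceptSet.1 h))]

/-- Since `B ≤ A`, the sum on the left is at most `max A x + min A x = x + A`. It is nonnegative
unless `x < B`, and there the two sides agree. -/
theorem sq_max_add_min_le {A B : ℝ} (h : |B| ≤ A) (x : ℝ) :
    (max A x + min B x) ^ 2 ≤ (x + A) ^ 2 := by
  obtain ⟨h1, h2⟩ := abs_le.1 h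
  rcases le_total A x with hx | hx
  · rw [max_eq_right hx, min_eq_left (h2.trans hx)]
    gcongr
    linarith
  · rw [max_eq_left hx]
    rcases le_total B x with hB | hB
    · rw [min_eq_left hB]
      apply sq_le_sq' <;> linarith
    · rw [min_eq_right hB, add_comm]

theorem acceptError_le (hf : IsHonestDensity f Δ) {A B : ℝ} (h : |B| ≤ A) (c : ℝ) :
    acceptError f c A B ≤ ∫ x in acceptSet c A B, (x + A) ^ 2 ∂noiseLaw f := by
  refine integral_mono_of_nonneg (Filter.Eventually.of_forall fun x => sq_nonneg _)
    (hf.integrable_sq A).integrableOn (Filter.Eventually.of_forall fun x => ?_)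
  exact sq_max_add_min_le h x

/-- By symmetry, averaging over `x` and `-x` cancels the cross term. -/
theorem integral_add_sq (hf : IsHonestDensity f Δ) (z : ℝ) :
    ∫ x, (x + z) ^ 2 ∂noiseLaw f = (∫ x, x ^ 2 ∂noiseLaw f) + z ^ 2 := by
  have := hf.isProbabilityMeasure
  have h := hf.integral_comp_neg fun x => (x + z) ^ 2
  have h2 : Integrable (fun x : ℝ => x ^ 2) (noiseLaw f) := by simpa using hf.integrable_sq 0
  have h3 : ∫ x, ((x + z) ^ 2 + (-x + z) ^ 2) ∂noiseLaw f
      = 2 * ((∫ x, x ^ 2 ∂noiseLaw f) + z ^ 2) := by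
    have : ∀ x : ℝ, (x + z) ^ 2 + (-x + z) ^ 2 = 2 * (x ^ 2 + z ^ 2) := fun x => by ring
    simp_rw [this]
    rw [integral_const_mul, integral_add h2 (integrable_const _)]
    simp
  have hi : Integrable (fun x => (-x + z) ^ 2) (noiseLaw f) := by
    convert hf.integrable_sq (-z) using 2
    ring
  rw [integral_add (hf.integrable_sq z) hi, h] at h3
  linarith

/-- Among the sets of given probability, upper half-lines maximize the integral of a function
that is monotone on the range of the noise. -/
theorem setIntegral_le_setIntegral_Ici (hf : IsHonestDensity f Δ) {S : Set ℝ}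
    (hS : MeasurableSet S) {t A : ℝ} (ht : -A ≤ t) (hA : Δ ≤ A)
    (h : (noiseLaw f).real S = (noiseLaw f).real (Ici t)) :
    ∫ x in S, (x + A) ^ 2 ∂noiseLaw f ≤ ∫ x in Ici t, (x + A) ^ 2 ∂noiseLaw f := by
  have := hf.isProbabilityMeasure
  -- Bathtub principle: after this subtraction the integrand is nonnegative above `t` and
  -- nonpositive below it on the range of the noise; the equal masses make the constants cancel.
  have hi : Integrable (fun x => (x + A) ^ 2 - (t + A) ^ 2) (noiseLaw f) :=
    (hf.integrable_sq A).sub (integrable_const _)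
  have key : ∫ x in S, ((x + A) ^ 2 - (t + A) ^ 2) ∂noiseLaw f
      ≤ ∫ x in Ici t, ((x + A) ^ 2 - (t + A) ^ 2) ∂noiseLaw f := by
    rw [← integral_indicator hS, ← integral_indicator measurableSet_Ici]
    refine integral_mono_ae (hi.indicator hS) (hi.indicator measurableSet_Ici) ?_
    filter_upwards [hf.ae_abs_le] with x hx
    have hx' := (abs_le.1 hx).1
    rcases le_or_gt t x with hxt | hxt
    · have : (t + A) ^ 2 ≤ (x + A) ^ 2 := by gcongr; linarith
      rw [indicator_of_mem (show x ∈ Ici t from hxt)]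
      by_cases hxS : x ∈ S
      · rw [indicator_of_mem hxS]
      · rw [indicator_of_notMem hxS]
        linarith
    · have : (x + A) ^ 2 ≤ (t + A) ^ 2 := by gcongr; linarith
      rw [indicator_of_notMem (show x ∉ Ici t from not_le.2 hxt)]
      by_cases hxS : x ∈ S
      · rw [indicator_of_mem hxS]
        linarith
      · rw [indicator_of_notMem hxS]
  rw [integral_sub (hf.integrable_sq A).integrableOn (integrable_const _),
    integral_sub (hf.integrable_sq A).integrableOn (integrable_const _)] at key
  simp only [integral_const, measureReal_restrict_apply_univ, h] at key
  linarith

theorem acceptSet_subset_Ici (c A B : ℝ) : acceptSet c A B ⊆ Ici (A - c) := fun x hx => by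
  have h : max A x - min B x ≤ c := hx
  have := le_max_left A x
  have := min_le_right B x
  simp only [mem_Ici]
  linarith

theorem exists_nuFun_ge_of_abs_le (hΔ : 0 < Δ) (hη : 2 ≤ η) (hf : IsHonestDensity f Δ) {A B : ℝ}
    (h : |B| ≤ A) : ∃ z ∈ zRange Δ η, kFun Δ f η z = acceptProb f (η * Δ) A B ∧
      acceptError f (η * Δ) A B ≤ nuFun Δ f η z := by
  have := hf.isProbabilityMeasure
  set S := acceptSet (η * Δ) A B with hS
  have hSm : MeasurableSet S := measurableSet_acceptSet _ _ _
  obtain ⟨z, hz, hkz⟩ := (bijOn_kFun (η := η) hΔ hf).surjOn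
    (show acceptProb f (η * Δ) A B ∈ Icc 0 1 from ⟨measureReal_nonneg, measureReal_le_one⟩)
  refine ⟨z, hz, hkz, (acceptError_le hf h _).trans ?_⟩
  have hηΔ : 2 * Δ ≤ η * Δ := by gcongr
  have hl : (η - 1) * Δ ∈ zRange Δ η := ⟨le_rfl, by linarith⟩
  have hr : (η + 1) * Δ ∈ zRange Δ η := ⟨by linarith, le_rfl⟩
  have hΔz : Δ ≤ z := by linarith [hz.1]
  have hreal : (noiseLaw f).real S = (noiseLaw f).real (Ici (z - η * Δ)) := by
    rw [← kFun_eq_real hf hz.2, hkz, acceptProb]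
  rw [nuFun_eq_setIntegral hf hz.2]
  obtain ⟨hB1, hB2⟩ := abs_le.1 h
  rcases lt_or_ge A Δ with hA | hA
  -- Here every honest noise is accepted because `2Δ ≤ ηΔ`, so `z` is the left endpoint, which is at
  -- least `Δ`.
  · have hSae : ∀ᵐ x ∂noiseLaw f, x ∈ S := by
      filter_upwards [hf.ae_abs_le] with x hx
      obtain ⟨hx1, hx2⟩ := abs_le.1 hx
      have h1 : max A x ≤ Δ := max_le hA.le hx2
      have h2 : -Δ ≤ min B x := le_min (by linarith) hx1
      change max A x - min B x ≤ η * Δ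
      linarith
    have h1 : kFun Δ f η z = 1 := by
      rw [hkz, acceptProb, ← hS,
        measureReal_congr (Filter.eventuallyEq_univ.2 hSae : S =ᵐ[noiseLaw f] univ), probReal_univ]
    have hzl : z = (η - 1) * Δ :=
      (bijOn_kFun hΔ hf).injOn hz hl (h1.trans (kFun_left hΔ hf).symm)
    rw [Measure.restrict_eq_self_of_ae_mem hSae, hzl, restrict_Ici_left hf, ← hzl,
      integral_add_sq hf, integral_add_sq hf]
    have : A ^ 2 ≤ z ^ 2 := by
      have := (abs_nonneg B).trans h
      gcongr
      linarith
    linarith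
  rcases le_or_gt A z with hAz | hAz
  · refine (setIntegral_le_setIntegral_Ici hf hSm (by linarith [hz.1]) hA hreal).trans ?_
    refine integral_mono_ae (hf.integrable_sq A).integrableOn (hf.integrable_sq z).integrableOn ?_
    filter_upwards [ae_restrict_of_ae hf.ae_abs_le] with x hx
    have := (abs_le.1 hx).1
    gcongr
    linarith
  -- Acceptance forces `x ≥ A - ηΔ`, beyond the threshold `z - ηΔ` of the same probability. Strict
  -- monotonicity then leaves only probability 0; truncating `A` keeps `w` where it applies.
  · set w := min A ((η + 1) * Δ) with hw
    have hwz : w ∈ zRange Δ η := ⟨le_min (hz.1.trans hAz.le) hr.1, min_le_right _ _⟩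
    have hle : kFun Δ f η z ≤ kFun Δ f η w := by
      rw [kFun_eq_real hf hwz.2, hkz, acceptProb]
      refine measureReal_mono ((acceptSet_subset_Ici _ _ _).trans (Ici_subset_Ici.2 ?_))
      linarith [min_le_left A ((η + 1) * Δ)]
    have hwz' : w ≤ z := by
      by_contra! hlt
      exact absurd (strictAntiOn_kFun hf hz hwz hlt) (not_lt.2 hle)
    have hzr : z = (η + 1) * Δ := by
      rcases min_le_iff.1 hwz' with h' | h'
      · linarith
      · exact le_antisymm hz.2 h'
    have hS0 : (noiseLaw f).restrict S = 0 := by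
      rw [Measure.restrict_eq_zero, ← measureReal_eq_zero_iff]
      rw [hzr, kFun_right] at hkz
      exact hkz.symm
    rw [hS0, integral_zero_measure]
    exact integral_nonneg fun x => sq_nonneg _

/-- Whatever the extreme adversarial noises are, some point of the curve `(k_η, ν_η)` has the same
acceptance probability and at least the same error. -/
theorem exists_nuFun_ge (hΔ : 0 < Δ) (hη : 2 ≤ η) (hf : IsHonestDensity f Δ) {A B : ℝ}
    (h : B ≤ A) : ∃ z ∈ zRange Δ η, kFun Δ f η z = acceptProb f (η * Δ) A B ∧
      acceptError f (η * Δ) A B ≤ nuFun Δ f η z := by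
  rcases le_total (-A) B with hAB | hAB
  · exact exists_nuFun_ge_of_abs_le hΔ hη hf (abs_le.2 ⟨hAB, h⟩)
  · rw [← acceptProb_neg hf, ← acceptError_neg hf]
    exact exists_nuFun_ge_of_abs_le hΔ hη hf (abs_le.2 ⟨by linarith, by linarith⟩)

/-- Adversaries that all use the noise `z` realize the point of the curve with parameter `z`. -/
theorem acceptSet_self_ae_eq (hΔ : 0 < Δ) (hη : 2 ≤ η) (hf : IsHonestDensity f Δ) {z : ℝ}
    (hz : z ∈ zRange Δ η) : acceptSet (η * Δ) z z =ᵐ[noiseLaw f] Ici (z - η * Δ) := by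
  have hηΔ : 2 * Δ ≤ η * Δ := by gcongr
  filter_upwards [hf.ae_abs_le] with x hx
  have hxz : x ≤ z := by linarith [(abs_le.1 hx).2, hz.1]
  refine propext ?_
  change max z x - min z x ≤ η * Δ ↔ z - η * Δ ≤ x
  rw [max_eq_left hxz, min_eq_right hxz]
  constructor <;> intro <;> linarith

theorem acceptProb_self (hΔ : 0 < Δ) (hη : 2 ≤ η) (hf : IsHonestDensity f Δ) {z : ℝ}
    (hz : z ∈ zRange Δ η) : acceptProb f (η * Δ) z z = kFun Δ f η z := by
  rw [kFun_eq_real hf hz.2]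
  exact measureReal_congr (acceptSet_self_ae_eq hΔ hη hf hz)

theorem acceptError_self (hΔ : 0 < Δ) (hη : 2 ≤ η) (hf : IsHonestDensity f Δ) {z : ℝ}
    (hz : z ∈ zRange Δ η) : acceptError f (η * Δ) z z = nuFun Δ f η z := by
  rw [nuFun_eq_setIntegral hf hz.2, acceptError,
    setIntegral_congr_set (acceptSet_self_ae_eq hΔ hη hf hz)]
  congr 1
  ext x
  rw [max_add_min, add_comm]

/-! ### From the game to averages over the adversarial law -/

variable {m : ℕ}

theorem maxReport_eq [Nonempty (Fin m)] (ω : Outcome m) :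
    maxReport ω = ω.2.1 + max (⨆ i, ω.2.2.2 i) ω.2.2.1 := by
  obtain ⟨p, u, x, a⟩ := ω
  refine le_antisymm (ciSup_le ?_) ?_
  · rw [Fin.forall_iff_succAbove p]
    refine ⟨?_, fun i => ?_⟩
    · simp [report]
    · simpa [report] using Or.inl (le_ciSup (Finite.bddAbove_range a) i)
  · have hle : ∀ i, report (p, u, x, a) i ≤ maxReport (p, u, x, a) :=
      le_ciSup (Finite.bddAbove_range (report (p, u, x, a)))
    rw [← le_sub_iff_add_le']
    refine max_le (ciSup_le fun i => ?_) ?_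
    · simpa [report, le_sub_iff_add_le'] using hle (p.succAbove i)
    · simpa [report, le_sub_iff_add_le'] using hle p

theorem minReport_eq [Nonempty (Fin m)] (ω : Outcome m) :
    minReport ω = ω.2.1 + min (⨅ i, ω.2.2.2 i) ω.2.2.1 := by
  obtain ⟨p, u, x, a⟩ := ω
  refine le_antisymm ?_ (le_ciInf ?_)
  · have hle : ∀ i, minReport (p, u, x, a) ≤ report (p, u, x, a) i :=
      ciInf_le (Finite.bddBelow_range (report (p, u, x, a)))
    rw [← sub_le_iff_le_add']
    refine le_min (le_ciInf fun i => ?_) ?_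
    · simpa [report, sub_le_iff_le_add, add_comm] using hle (p.succAbove i)
    · simpa [report, sub_le_iff_le_add, add_comm] using hle p
  · rw [Fin.forall_iff_succAbove p]
    refine ⟨?_, fun i => ?_⟩
    · simp [report]
    · simpa [report] using Or.inl (ciInf_le (Finite.bddBelow_range a) i)

/-- The pairs of honest and adversarial noises that lead to acceptance at tolerance `c`. -/
def acceptPairs (m : ℕ) (c : ℝ) : Set (ℝ × (Fin m → ℝ)) :=
  {p | p.1 ∈ acceptSet c (⨆ i, p.2 i) (⨅ i, p.2 i)}

theorem measurable_iSup_snd : Measurable fun p : ℝ × (Fin m → ℝ) => ⨆ i, p.2 i :=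
  Measurable.iSup fun i => (measurable_pi_apply i).comp measurable_snd

theorem measurable_iInf_snd : Measurable fun p : ℝ × (Fin m → ℝ) => ⨅ i, p.2 i :=
  Measurable.iInf fun i => (measurable_pi_apply i).comp measurable_snd

theorem measurableSet_acceptPairs (c : ℝ) : MeasurableSet (acceptPairs m c) :=
  measurableSet_le ((measurable_iSup_snd.max measurable_fst).sub
    (measurable_iInf_snd.min measurable_fst)) measurable_const

theorem measurePreserving_noises (hf : IsHonestDensity f Δ) {M : ℝ} (hM : 0 < M)
    (g : Measure (Fin m → ℝ)) [IsProbabilityMeasure g] :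
    MeasurePreserving (fun ω : Outcome m => ω.2.2) (gameLaw m M f g) ((noiseLaw f).prod g) := by
  have := hf.isProbabilityMeasure
  have : IsProbabilityMeasure (uniformOn (univ : Set (Fin (m + 1)))) :=
    isProbabilityMeasure_uniformOn finite_univ univ_nonempty
  have : IsProbabilityMeasure (ProbabilityTheory.cond (volume : Measure ℝ) (Icc (-M) M)) := by
    refine cond_isProbabilityMeasure_of_finite ?_ ?_
    · simp [Real.volume_Icc, hM]
    · simp [Real.volume_Icc]
  exact measurePreserving_snd.comp measurePreserving_snd

theorem accepted_eq_preimage [Nonempty (Fin m)] :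
    accepted m Δ η = (fun ω : Outcome m => ω.2.2) ⁻¹' acceptPairs m (η * Δ) := by
  ext ω
  simp only [accepted, acceptPairs, acceptSet, mem_ofPred_eq, mem_preimage, maxReport_eq,
    minReport_eq, add_sub_add_left_eq_sub]

/-- Fubini, with the adversarial noises outermost. The bound is required only on acceptance, as
adversarial noises may be unbounded. -/
theorem setIntegral_acceptPairs (hf : IsHonestDensity f Δ) (g : Measure (Fin m → ℝ))
    [IsProbabilityMeasure g] {c : ℝ} {φ : ℝ × (Fin m → ℝ) → ℝ} (hφ : Measurable φ) (C : ℝ)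
    (h : ∀ p ∈ acceptPairs m c, |p.1| ≤ Δ → |φ p| ≤ C) :
    Integrable (fun a => ∫ x in acceptSet c (⨆ i, a i) (⨅ i, a i), φ (x, a) ∂noiseLaw f) g ∧
    ∫ p in acceptPairs m c, φ p ∂(noiseLaw f).prod g =
      ∫ a, ∫ x in acceptSet c (⨆ i, a i) (⨅ i, a i), φ (x, a) ∂noiseLaw f ∂g := by
  have := hf.isProbabilityMeasure
  have hi : Integrable ((acceptPairs m c).indicator φ) ((noiseLaw f).prod g) := by
    refine Integrable.of_bound
      (hφ.indicator (measurableSet_acceptPairs c)).aestronglyMeasurable (max C 0) ?_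
    filter_upwards [Measure.quasiMeasurePreserving_fst.ae hf.ae_abs_le] with p hp
    by_cases hpS : p ∈ acceptPairs m c
    · rw [indicator_of_mem hpS]
      exact (h p hpS hp).trans (le_max_left _ _)
    · simp [indicator_of_notMem hpS]
  have heq : ∀ a : Fin m → ℝ, ∫ x, (acceptPairs m c).indicator φ (x, a) ∂noiseLaw f
      = ∫ x in acceptSet c (⨆ i, a i) (⨅ i, a i), φ (x, a) ∂noiseLaw f := fun a => by
    rw [← integral_indicator (measurableSet_acceptSet _ _ _)]
    rfl
  refine ⟨by simpa only [heq] using hi.integral_prod_right, ?_⟩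
  rw [← integral_indicator (measurableSet_acceptPairs c), integral_prod_symm _ hi]
  simp only [heq]

/-- The mean acceptance probability under the law `g` of the adversarial noises. -/
def meanProb (f : ℝ → ℝ) (c : ℝ) (g : Measure (Fin m → ℝ)) : ℝ :=
  ∫ a, acceptProb f c (⨆ i, a i) (⨅ i, a i) ∂g

/-- The mean of `acceptError` under the law `g` of the adversarial noises. -/
def meanError (f : ℝ → ℝ) (c : ℝ) (g : Measure (Fin m → ℝ)) : ℝ :=
  ∫ a, acceptError f c (⨆ i, a i) (⨅ i, a i) ∂g

theorem acceptProb_eq_setIntegral (c A B : ℝ) :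
    acceptProb f c A B = ∫ _ in acceptSet c A B, (1 : ℝ) ∂noiseLaw f := by
  simp [acceptProb]

theorem integrable_acceptProb (hf : IsHonestDensity f Δ) (c : ℝ) (g : Measure (Fin m → ℝ))
    [IsProbabilityMeasure g] :
    Integrable (fun a => acceptProb f c (⨆ i, a i) (⨅ i, a i)) g := by
  simp only [acceptProb_eq_setIntegral]
  exact (setIntegral_acceptPairs hf g (φ := fun _ => 1) measurable_const 1 (by simp)).1

theorem real_acceptPairs (hf : IsHonestDensity f Δ) (c : ℝ) (g : Measure (Fin m → ℝ))
    [IsProbabilityMeasure g] :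
    ((noiseLaw f).prod g).real (acceptPairs m c) = meanProb f c g := by
  simp only [meanProb, acceptProb_eq_setIntegral]
  rw [← (setIntegral_acceptPairs hf g (φ := fun _ => 1) measurable_const 1 (by simp)).2]
  simp

theorem measurable_sq_sum_extremes : Measurable fun p : ℝ × (Fin m → ℝ) =>
    (max (⨆ i, p.2 i) p.1 + min (⨅ i, p.2 i) p.1) ^ 2 :=
  ((measurable_iSup_snd.max measurable_fst).add (measurable_iInf_snd.min measurable_fst)).pow_const
    2

/-- Acceptance keeps both extremes within `c` of the honest noise, which has size at most `Δ`. -/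
theorem sq_sum_extremes_le {c : ℝ} (p : ℝ × (Fin m → ℝ)) (hp : p ∈ acceptPairs m c)
    (hx : |p.1| ≤ Δ) :
    |(max (⨆ i, p.2 i) p.1 + min (⨅ i, p.2 i) p.1) ^ 2| ≤ (2 * Δ + c) ^ 2 := by
  have h : max (⨆ i, p.2 i) p.1 - min (⨅ i, p.2 i) p.1 ≤ c := hp
  obtain ⟨h1, h2⟩ := abs_le.1 hx
  have h3 := le_max_right (⨆ i, p.2 i) p.1
  have h4 := min_le_right (⨅ i, p.2 i) p.1
  rw [abs_of_nonneg (sq_nonneg _)]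
  apply sq_le_sq' <;> linarith

theorem integrable_acceptError (hf : IsHonestDensity f Δ) (c : ℝ) (g : Measure (Fin m → ℝ))
    [IsProbabilityMeasure g] :
    Integrable (fun a => acceptError f c (⨆ i, a i) (⨅ i, a i)) g :=
  (setIntegral_acceptPairs hf g measurable_sq_sum_extremes _ sq_sum_extremes_le).1

theorem setIntegral_sq_sum_extremes (hf : IsHonestDensity f Δ) (c : ℝ)
    (g : Measure (Fin m → ℝ)) [IsProbabilityMeasure g] :
    ∫ p in acceptPairs m c, (max (⨆ i, p.2 i) p.1 + min (⨅ i, p.2 i) p.1) ^ 2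
      ∂(noiseLaw f).prod g = meanError f c g :=
  (setIntegral_acceptPairs hf g measurable_sq_sum_extremes _ sq_sum_extremes_le).2

theorem PA_eq [Nonempty (Fin m)] (hf : IsHonestDensity f Δ) {M : ℝ} (hM : 0 < M)
    (g : Measure (Fin m → ℝ)) [IsProbabilityMeasure g] :
    PA m M Δ f g η = meanProb f (η * Δ) g := by
  rw [PA, accepted_eq_preimage, measureReal_def, (measurePreserving_noises hf hM g).measure_preimage
    (measurableSet_acceptPairs _).nullMeasurableSet, ← real_acceptPairs hf, measureReal_def]

/-- In the midrange error `u` cancels, leaving minus half the sum of the extreme noises; hence the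
factor 4. Conditioning divides by the acceptance probability. -/
theorem MSE_eq [Nonempty (Fin m)] (hf : IsHonestDensity f Δ) {M : ℝ} (hM : 0 < M)
    (g : Measure (Fin m → ℝ)) [IsProbabilityMeasure g] :
    MSE m M Δ f g η = meanError f (η * Δ) g / (4 * meanProb f (η * Δ) g) := by
  have hmp := measurePreserving_noises hf hM g
  have hsq : ∀ ω : Outcome m, (ω.2.1 - (maxReport ω + minReport ω) / 2) ^ 2
      = (max (⨆ i, ω.2.2.2 i) ω.2.2.1 + min (⨅ i, ω.2.2.2 i) ω.2.2.1) ^ 2 / 4 := fun ω => by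
    rw [maxReport_eq, minReport_eq]
    ring
  have hint : ∫ ω in accepted m Δ η,
      (max (⨆ i, ω.2.2.2 i) ω.2.2.1 + min (⨅ i, ω.2.2.2 i) ω.2.2.1) ^ 2 ∂gameLaw m M f g
      = meanError f (η * Δ) g := by
    rw [← setIntegral_sq_sum_extremes hf, ← hmp.map_eq,
      setIntegral_map (measurableSet_acceptPairs _)
        measurable_sq_sum_extremes.aestronglyMeasurable hmp.measurable.aemeasurable,
      accepted_eq_preimage]
  have hPA : ((gameLaw m M f g) (accepted m Δ η)).toReal = meanProb f (η * Δ) g :=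
    PA_eq hf hM g
  rw [MSE, ProbabilityTheory.cond, integral_smul_measure]
  simp only [hsq]
  rw [integral_div, hint, ENNReal.toReal_inv, hPA, smul_eq_mul, ← div_eq_inv_mul, div_div]

/-! ### Attainable pairs and the convex hull -/

open scoped Pointwise in
/-- Every law of the adversarial noises is dominated by a point of the convex hull of the curve. -/
theorem exists_mem_curveHull_ge [Nonempty (Fin m)] (hΔ : 0 < Δ) (hη : 2 ≤ η)
    (hf : IsHonestDensity f Δ) (g : Measure (Fin m → ℝ)) [IsProbabilityMeasure g] :
    ∃ y, (meanProb f (η * Δ) g, y) ∈ curveHull Δ f η ∧ meanError f (η * Δ) g ≤ y := by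
  -- Adding a downward vertical ray to the hull turns domination into membership in a closed convex
  -- set, which also contains the mean.
  set D : Set (ℝ × ℝ) := curveHull Δ f η + ({0} : Set ℝ) ×ˢ (Iic 0 : Set ℝ) with hD
  have hDc : IsClosed D :=
    (isClosed_singleton.prod isClosed_Iic).add_left_of_isCompact (isCompact_curveHull hf)
  have hDv : Convex ℝ D := (convex_convexHull ℝ _).add ((convex_singleton 0).prod (convex_Iic 0))
  have hmem : ∀ a : Fin m → ℝ, (acceptProb f (η * Δ) (⨆ i, a i) (⨅ i, a i),
      acceptError f (η * Δ) (⨆ i, a i) (⨅ i, a i)) ∈ D := fun a => by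
    obtain ⟨z, hz, hk, he⟩ := exists_nuFun_ge (A := ⨆ i, a i) (B := ⨅ i, a i) hΔ hη hf
      (ciInf_le_ciSup (Finite.bddBelow_range a) (Finite.bddAbove_range a))
    refine ⟨_, mem_curveHull hz,
      (0, acceptError f (η * Δ) (⨆ i, a i) (⨅ i, a i) - nuFun Δ f η z), ⟨rfl, ?_⟩, ?_⟩
    · simpa using he
    · simp [hk]
  have hp := integrable_acceptProb hf (η * Δ) g
  have he := integrable_acceptError hf (η * Δ) g
  have h := hDv.integral_mem hDc (Filter.Eventually.of_forall hmem) (hp.prodMk he)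
  rw [integral_pair hp he] at h
  obtain ⟨⟨q, y⟩, hqy, ⟨r, t⟩, ⟨hr, ht⟩, hsum⟩ := h
  simp only [mem_singleton_iff, mem_Iic] at hr ht
  simp only [Prod.mk_add_mk, Prod.mk.injEq, hr, add_zero] at hsum
  refine ⟨y, ?_, ?_⟩
  · rw [meanProb, ← hsum.1]
    exact hqy
  · rw [meanError, ← hsum.2]
    linarith

/-- Every point of the convex hull of the curve is realized by a law of the adversarial noises. -/
theorem exists_law_of_mem_curveHull [Nonempty (Fin m)] (hΔ : 0 < Δ) (hη : 2 ≤ η)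
    (hf : IsHonestDensity f Δ) {p : ℝ × ℝ} (hp : p ∈ curveHull Δ f η) :
    ∃ g : Measure (Fin m → ℝ), IsProbabilityMeasure g ∧
      p = (meanProb f (η * Δ) g, meanError f (η * Δ) g) := by
  refine convexHull_min (t := {p | ∃ g : Measure (Fin m → ℝ), IsProbabilityMeasure g ∧
    p = (meanProb f (η * Δ) g, meanError f (η * Δ) g)}) ?_ ?_ hp
  · rintro _ ⟨z, hz, rfl⟩
    refine ⟨Measure.dirac fun _ => z, inferInstance, ?_⟩
    simp [meanProb, meanError, acceptProb_self hΔ hη hf hz, acceptError_self hΔ hη hf hz]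
  · rintro _ ⟨g₁, hg₁, rfl⟩ _ ⟨g₂, hg₂, rfl⟩ a b ha hb hab
    -- Both averages are affine in the law, so mixing laws mixes points.
    refine ⟨ENNReal.ofReal a • g₁ + ENNReal.ofReal b • g₂, ⟨?_⟩, ?_⟩
    · simp [← ENNReal.ofReal_add ha hb, hab]
    · have hp₁ := (integrable_acceptProb hf (η * Δ) g₁).smul_measure (c := ENNReal.ofReal a) (by simp)
      have hp₂ := (integrable_acceptProb hf (η * Δ) g₂).smul_measure (c := ENNReal.ofReal b) (by simp)
      have he₁ := (integrable_acceptError hf (η * Δ) g₁).smul_measure (c := ENNReal.ofReal a) (by simp)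
      have he₂ := (integrable_acceptError hf (η * Δ) g₂).smul_measure (c := ENNReal.ofReal b) (by simp)
      simp only [meanProb, meanError]
      rw [integral_add_measure hp₁ hp₂, integral_add_measure he₁ he₂]
      simp [integral_smul_measure, ENNReal.toReal_ofReal, ha, hb]

end CodingGame

end

/-! ### The optimal value -/

theorem theorem2 (M Δ : ℝ) (hM : 0 < M) (hΔ : 0 < Δ) (f : ℝ → ℝ)
    (hf : CodingGame.IsHonestDensity f Δ)
    (η : ℝ) (hη : 2 ≤ η) (N : ℕ) (hN : 2 ≤ N) (α : ℝ) (hα₀ : 0 < α) (hα₁ : α ≤ 1) :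
    BijOn (CodingGame.kFun Δ f η) (CodingGame.zRange Δ η) (Icc 0 1) ∧
    IsGreatest (CodingGame.feasibleMSE (N - 1) M Δ f η α) (CodingGame.optMSE N M Δ f η α) ∧
    CodingGame.optMSE N M Δ f η α =
      CodingGame.concaveEnvelope (Icc 0 1) (CodingGame.hFun Δ f η) α / (4 * α) := by
  have : Nonempty (Fin (N - 1)) := ⟨⟨0, by omega⟩⟩
  have henv := CodingGame.isGreatest_concaveEnvelope (convex_Icc 0 1)
    (CodingGame.isCompact_curveHull (η := η) hf) (CodingGame.curveHull_eq_graph hΔ hf)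
    (q := α) ⟨hα₀.le, hα₁⟩
  have hmax : IsGreatest (CodingGame.feasibleMSE (N - 1) M Δ f η α)
      (CodingGame.concaveEnvelope (Icc 0 1) (CodingGame.hFun Δ f η) α / (4 * α)) := by
    constructor
    · obtain ⟨g, hg, hgeq⟩ :=
        CodingGame.exists_law_of_mem_curveHull (m := N - 1) hΔ hη hf henv.1
      obtain ⟨h1, h2⟩ := Prod.mk.inj hgeq
      refine ⟨g, hg, ?_, ?_⟩
      · rw [CodingGame.PA_eq hf hM, ← h1]
      · rw [CodingGame.MSE_eq hf hM, ← h1, ← h2]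
    · rintro _ ⟨g, hg, hPA, rfl⟩
      rw [CodingGame.PA_eq hf hM] at hPA
      rw [CodingGame.MSE_eq hf hM]
      obtain ⟨y, hy, hle⟩ := CodingGame.exists_mem_curveHull_ge hΔ hη hf g
      set q := CodingGame.meanProb f (η * Δ) g
      have hq : 0 < q := hα₀.trans_le hPA
      -- The right end of the curve is the origin; scaling towards it moves the probability from `q`
      -- to `α` while preserving the ratio of error to probability.
      have hzero : ((0 : ℝ), (0 : ℝ)) ∈ CodingGame.curveHull Δ f η := by
        have h := CodingGame.mem_curveHull (f := f) (Δ := Δ) (η := η)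
          (z := (η + 1) * Δ) ⟨by linarith, le_rfl⟩
        rwa [CodingGame.kFun_right, CodingGame.nuFun_right] at h
      have hscale : (α, α / q * y) ∈ CodingGame.curveHull Δ f η := by
        have h := (convex_convexHull ℝ _ : Convex ℝ (CodingGame.curveHull Δ f η)).smul_mem_of_zero_mem
          hzero hy (t := α / q) ⟨by positivity, (div_le_one hq).2 hPA⟩
        simpa [hq.ne', CodingGame.curveHull] using h
      have hub : α / q * y ≤ _ := henv.2 hscale
      calc CodingGame.meanError f (η * Δ) g / (4 * q) ≤ y / (4 * q) := by gcongr
        _ = α / q * y / (4 * α) := by field_simp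
        _ ≤ _ := by gcongr
  have hopt := hmax.csSup_eq
  refine ⟨CodingGame.bijOn_kFun hΔ hf, ?_, hopt⟩
  rw [CodingGame.optMSE, hopt]
  exact hmax
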